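/- Let $\mathbb{F}$ be a finite field and let $n>1$ be an integer. Call a subgroup $G$ of $\mathrm{GL}(n,\mathbb{F})$ primitive if it acts irreducibly on $V=\mathbb{F}^n$ and there are no integer $k>1$ and nonzero subspaces $V_1,\dots,V_k$ of $V$ such that $V=V_1\oplus\cdots\oplus V_k$ and every element of $G$ permutes the $V_i$. Let $G$ and $H$ be subgroups of $\mathrm{GL}(n,\mathbb{F})$ that are nilpotent and primitive. Then $G$ and $H$ are conjugate in $\mathrm{GL}(n,\mathbb{F})$ if and only if they are isomorphic as abstract groups. -/

import Mathlib

namespace NilpotentPrimitive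

/-- The natural representation of a linear group `G ≤ GL(n, F)` on the space `F^n`
(column vectors), an element `g` of `G` acting as `v ↦ g v`. -/
noncomputable def naturalRep {F : Type*} [Field F] {n : ℕ}
    (G : Subgroup (Matrix.GeneralLinearGroup (Fin n) F)) :
    Representation F G (Fin n → F) where
  toFun g := Matrix.toLin' (g : Matrix.GeneralLinearGroup (Fin n) F).val
  map_one' := by simp [Module.End.one_eq_id]
  map_mul' g h := by simp [Matrix.toLin'_mul, Module.End.mul_eq_comp]

/-- A system of imprimitivity of `G ≤ GL(n, F)` with components `V 0, …, V (k - 1)`, `k > 1`: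
nonzero subspaces of `F^n` whose direct sum is `F^n` and which are permuted among
themselves by `G`. -/
structure IsImprimitivitySystem {F : Type*} [Field F] {n : ℕ}
    (G : Subgroup (Matrix.GeneralLinearGroup (Fin n) F))
    {k : ℕ} (V : Fin k → Submodule F (Fin n → F)) : Prop where
  one_lt : 1 < k
  ne_bot : ∀ i, V i ≠ ⊥
  isInternal : DirectSum.IsInternal V
  permutes : ∀ g : G, ∀ i, ∃ j, (V i).map (naturalRep G g) = V j

/-- A linear group is primitive if it is irreducible and has no system of imprimitivity. -/
def IsPrimitive {F : Type*} [Field F] {n : ℕ}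
    (G : Subgroup (Matrix.GeneralLinearGroup (Fin n) F)) : Prop :=
  (naturalRep G).IsIrreducible ∧
    ∀ (k : ℕ) (V : Fin k → Submodule F (Fin n → F)), ¬ IsImprimitivitySystem G V

end NilpotentPrimitive

/-! Let `A` be a maximal abelian normal subgroup of the nilpotent group `G`; it is its own
centralizer. Primitivity forces `F[A]` to act on `V` through a finite field `K`. Then `G` acts
semilinearly over `K`, `G/A` embeds in `Gal(K/F)`, and `G` is generated by `A` and an element `x`
acting as `l ↦ l ^ Q` on `K`, with `Nat.card K = Q ^ d`. A Hilbert 90 argument gives `x` an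
eigenvector `v`, whose line `K v` is `G`-stable, so `V = K v`. Everything is encoded by a generator
`ζ` of the image of `A` in `Kˣ` and by `γ` with `x v = γ v`, where `γ ^ S = ζ ^ s` for `S = 1 + Q +
⋯ + Q ^ (d - 1)`.

An isomorphic primitive group is a second faithful representation of `G`. Once the fields are
identified it has data `ζ ^ k` and `γ'` with `k` prime to the order of `ζ`. The two representations
need not be equivalent, but their images are conjugate as soon as `γ' = γ * ζ ^ z * t ^ (Q - 1)`:
the factor `ζ ^ z` is absorbed into `A` and `t` into a rescaling of `v`. By Hilbert 90 this amounts
to `(ζ ^ z) ^ S = ζ ^ (s * (k - 1))`, which is solvable by the divisibility `gcd_geom_sum_dvd`. That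
divisibility is where nilpotency (primes dividing the order of `ζ` divide `Q - 1`) and the
minimality of `d` (`K` is generated by `ζ`) enter.
`Representation.IsScalarOn.exists_intertwining_up_to_image` assembles the argument. -/

/-! ### Arithmetic of cyclic groups and of `Q ^ d - 1`. -/

/-- Applied to `Kˣ`, of order `S * (Q - 1)`, this gives both surjectivity of the norm onto the fixed
field and Hilbert 90. -/
theorem IsCyclic.exists_pow_eq_of_pow_eq_one {C : Type*} [CommGroup C] [IsCyclic C]
    [Finite C] {r s : ℕ} (hcard : Nat.card C = r * s) {c : C} (hc : c ^ r = 1) :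
    ∃ t : C, t ^ s = c := by
  obtain ⟨g, hg⟩ := IsCyclic.exists_monoid_generator (α := C)
  obtain ⟨k, rfl⟩ := Submonoid.mem_powers_iff _ _ |>.1 (hg c)
  have hord : orderOf g = r * s := by
    rw [← hcard]
    exact orderOf_eq_card_of_forall_mem_zpowers fun x => by
      obtain ⟨i, hi⟩ := Submonoid.mem_powers_iff _ _ |>.1 (hg x)
      exact ⟨i, by simpa using hi⟩
  have hpos : 0 < r * s := by rw [← hcard]; exact Nat.card_pos
  rw [← pow_mul] at hc
  have h := orderOf_dvd_of_pow_eq_one hc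
  rw [hord, mul_comm r s] at h
  obtain ⟨l, rfl⟩ := Nat.dvd_of_mul_dvd_mul_right (Nat.pos_of_mul_pos_right hpos) h
  exact ⟨g ^ l, by rw [← pow_mul, mul_comm]⟩

/-- Lifting the exponent; for `p = 2` the formula fails when `Q ≡ 3` mod 4 and `d` is even, whence
`h4`. -/
theorem padicValNat_pow_sub_one {p Q d : ℕ} [hp : Fact p.Prime] (hQ : 1 < Q) (h : p ∣ Q - 1)
    (h4 : p = 2 → 4 ∣ Q - 1) (hd : d ≠ 0) :
    padicValNat p (Q ^ d - 1) = padicValNat p (Q - 1) + padicValNat p d := by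
  have hpQ : ¬ p ∣ Q := fun hq => hp.out.one_lt.ne' <| Nat.dvd_one.1 <| by
    have := Nat.dvd_sub hq h
    rwa [Nat.sub_sub_self hQ.le] at this
  rcases hp.out.eq_two_or_odd' with rfl | hodd
  · have hne : Q ^ d - 1 ≠ 0 := Nat.sub_ne_zero_of_lt (Nat.one_lt_pow hd hQ)
    have h4' := h4 rfl
    have key := Int.two_pow_sub_pow' (x := (Q : ℤ)) (y := 1) d
      (by have := Int.natCast_dvd_natCast.2 h4'; rwa [Nat.cast_sub hQ.le] at this)
      (by exact_mod_cast hpQ)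
    have e1 : ((Q : ℤ) ^ d - 1 ^ d) = ((Q ^ d - 1 : ℕ) : ℤ) := by
      rw [Nat.cast_sub (Nat.one_le_pow _ _ (by omega))]; simp
    have e2 : ((Q : ℤ) - 1) = ((Q - 1 : ℕ) : ℤ) := by
      rw [Nat.cast_sub hQ.le]; simp
    rw [e1, e2] at key
    have e3 : (2 : ℤ) = ((2 : ℕ) : ℤ) := rfl
    rw [e3, Int.natCast_emultiplicity, Int.natCast_emultiplicity, Int.natCast_emultiplicity,
      ← padicValNat_eq_emultiplicity hne,
      ← padicValNat_eq_emultiplicity (Nat.sub_ne_zero_of_lt hQ),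
      ← padicValNat_eq_emultiplicity hd] at key
    exact_mod_cast key
  · simpa using padicValNat.pow_sub_pow (y := 1) hodd hQ h hpQ hd

/-- If `m` had smaller `p`-part, `d` could be replaced by `d / p`: lifting the exponent controls
`p`, and no other prime of `m` divides `(Q ^ d - 1) / (Q ^ (d / p) - 1)`. -/
theorem padicValNat_add_le_of_minimal {p Q m d : ℕ} [hp : Fact p.Prime] (hQ : 1 < Q) (hm : m ≠ 0)
    (hprime : ∀ l : ℕ, l.Prime → l ∣ m → l ∣ Q - 1) (hd : d ≠ 0) (hdm : m ∣ Q ^ d - 1)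
    (hmin : ∀ e, 0 < e → e < d → ¬ m ∣ Q ^ e - 1) (hpm : p ∣ Q - 1) (h4 : p = 2 → 4 ∣ Q - 1)
    (hpd : p ∣ d) : padicValNat p (Q - 1) + padicValNat p d ≤ padicValNat p m := by
  by_contra! hlt
  obtain ⟨e, rfl⟩ := hpd
  have he : e ≠ 0 := by rintro rfl; simp at hd
  have hle : e < p * e := by
    have := hp.out.two_le
    have : 0 < e := Nat.pos_of_ne_zero he
    nlinarith
  refine hmin e (Nat.pos_of_ne_zero he) hle ?_
  rw [padicValNat.mul hp.out.ne_zero he, padicValNat_self] at hlt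
  rw [Nat.dvd_iff_prime_pow_dvd_dvd]
  intro l i hl hli
  rcases Nat.eq_zero_or_pos i with rfl | hi
  · simp
  have hlm : l ∣ m := (dvd_pow_self l hi.ne').trans hli
  have hne : Q ^ e - 1 ≠ 0 := Nat.sub_ne_zero_of_lt (Nat.one_lt_pow he hQ)
  by_cases hlp : l = p
  · subst hlp
    rw [padicValNat_dvd_iff_le hne, padicValNat_pow_sub_one hQ hpm h4 he]
    rw [padicValNat_dvd_iff_le hm] at hli
    omega
  -- Since `Q ≡ 1` mod `l`, the cofactor is congruent to `p`, hence prime to `l ≠ p`.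
  · have hfac : Q ^ (p * e) - 1 = (∑ i ∈ Finset.range p, (Q ^ e) ^ i) * (Q ^ e - 1) := by
      rw [geom_sum_mul_of_one_le (Nat.one_le_pow _ _ (by omega)), mul_comm p e, pow_mul]
    have hcop : Nat.Coprime (l ^ i) (∑ i ∈ Finset.range p, (Q ^ e) ^ i) := by
      refine Nat.Coprime.pow_left _ ((Nat.Prime.coprime_iff_not_dvd hl).2 fun hdvd => hlp ?_)
      have hQ1 : Q ≡ 1 [MOD l] := ((Nat.modEq_iff_dvd' hQ.le).2 (hprime l hl hlm)).symm
      have hsum : (∑ i ∈ Finset.range p, (Q ^ e) ^ i) ≡ p [MOD l] := by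
        rw [← ZMod.natCast_eq_natCast_iff] at hQ1 ⊢
        simp [hQ1]
      exact (Nat.prime_dvd_prime_iff_eq hl hp.out).1 ((Nat.modEq_zero_iff_dvd.1
        (hsum.symm.trans (Nat.modEq_zero_iff_dvd.2 hdvd))))
    exact hcop.dvd_of_dvd_mul_left (hfac ▸ hli.trans hdm)

/-- Checked prime by prime. Where lifting the exponent applies, the geometric sum has the valuation
of `d`, which minimality bounds by that of `b`. The remaining case `p = 2`, `Q ≡ 3` mod 4 loses one
factor 2 in `b`, recovered from `k - 1` because `k` is odd. -/
theorem gcd_geom_sum_dvd {Q m d b k : ℕ} (hQ : 1 < Q) (hm : m ≠ 0)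
    (hprime : ∀ l : ℕ, l.Prime → l ∣ m → l ∣ Q - 1) (hd : d ≠ 0) (hdm : m ∣ Q ^ d - 1)
    (hmin : ∀ e, 0 < e → e < d → ¬ m ∣ Q ^ e - 1) (hb : m ∣ b * (Q - 1)) (hk : k.Coprime m) :
    (∑ i ∈ Finset.range d, Q ^ i).gcd m ∣ b * (k - 1) := by
  rw [Nat.dvd_iff_prime_pow_dvd_dvd]
  intro p j hp hpj
  have : Fact p.Prime := ⟨hp⟩
  rcases Nat.eq_zero_or_pos j with rfl | hj
  · simp
  rcases eq_or_ne b 0 with rfl | hb0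
  · simp
  have hjS := hpj.trans (Nat.gcd_dvd_left _ _)
  have hjm := hpj.trans (Nat.gcd_dvd_right _ _)
  have hpm : p ∣ m := (dvd_pow_self p hj.ne').trans hjm
  have hpQ := hprime p hp hpm
  have hQ0 : Q - 1 ≠ 0 := Nat.sub_ne_zero_of_lt hQ
  have hbv : padicValNat p m ≤ padicValNat p b + padicValNat p (Q - 1) := by
    rw [← padicValNat.mul hb0 hQ0, ← padicValNat_dvd_iff_le (mul_ne_zero hb0 hQ0)]
    exact pow_padicValNat_dvd.trans hb
  by_cases h4 : p = 2 → 4 ∣ Q - 1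
  · refine Dvd.dvd.mul_right ?_ _
    have hfac : (∑ i ∈ Finset.range d, Q ^ i) * (Q - 1) = Q ^ d - 1 :=
      geom_sum_mul_of_one_le hQ.le d
    have hS : (∑ i ∈ Finset.range d, Q ^ i) ≠ 0 := by
      intro h0
      rw [h0, zero_mul] at hfac
      exact Nat.sub_ne_zero_of_lt (Nat.one_lt_pow hd hQ) hfac.symm
    have hv := congrArg (padicValNat p) hfac
    rw [padicValNat.mul hS hQ0, padicValNat_pow_sub_one hQ hpQ h4 hd] at hv
    rw [padicValNat_dvd_iff_le hS] at hjS
    have hpd : p ∣ d := by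
      by_contra hpd
      rw [padicValNat.eq_zero_of_not_dvd hpd] at hv
      omega
    have := padicValNat_add_le_of_minimal hQ hm hprime hd hdm hmin hpQ h4 hpd
    rw [padicValNat_dvd_iff_le hb0]
    omega
  · push Not at h4
    obtain ⟨rfl, h4⟩ := h4
    have hv : padicValNat 2 (Q - 1) < 2 := by
      by_contra! h
      exact h4 ((padicValNat_dvd_iff_le hQ0).2 h)
    rw [padicValNat_dvd_iff_le hm] at hjm
    have hkodd : 2 ∣ k - 1 := by
      have : ¬ 2 ∣ k := fun h2 => by
        have := Nat.dvd_gcd h2 hpm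
        rw [hk] at this
        omega
      omega
    have hbj : 2 ^ (j - 1) ∣ b := (padicValNat_dvd_iff_le hb0).2 (by omega)
    calc 2 ^ j = 2 ^ (j - 1) * 2 := by rw [← pow_succ]; congr; omega
      _ ∣ b * (k - 1) := mul_dvd_mul hbj hkodd

theorem exists_zpow_pow_eq_of_gcd_dvd {C : Type*} [CommGroup C] {a : C} {S l : ℕ}
    (h : S.gcd (orderOf a) ∣ l) : ∃ z : ℤ, (a ^ z) ^ S = a ^ l := by
  obtain ⟨r, rfl⟩ := h
  refine ⟨S.gcdA (orderOf a) * r, ?_⟩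
  rw [← zpow_natCast, ← zpow_natCast, ← zpow_mul, Nat.cast_mul, Nat.gcd_eq_gcd_ab, add_mul,
    zpow_add, mul_assoc (orderOf a : ℤ), zpow_mul a (orderOf a : ℤ), zpow_natCast a (orderOf a),
    pow_orderOf_eq_one, one_zpow, mul_one]
  congr 1
  ring

/-! ### Nilpotent groups. -/

/-- A maximal abelian normal `A` works: climbing the upper central series, any `c` centralizing `A`
can be adjoined to `A` without losing normality or commutativity. -/
theorem Group.IsNilpotent.exists_normal_isMulCommutative_centralizer_le (G : Type*) [Group G]
    [Finite G] [hG : Group.IsNilpotent G] :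
    ∃ A : Subgroup G, A.Normal ∧ (∀ a ∈ A, ∀ b ∈ A, a * b = b * a) ∧
      Subgroup.centralizer (A : Set G) ≤ A := by
  obtain ⟨A, ⟨hA, hcomm⟩, hmax⟩ := (Set.toFinite
    {A : Subgroup G | A.Normal ∧ ∀ a ∈ A, ∀ b ∈ A, a * b = b * a}).exists_maximal
    ⟨⊥, inferInstance, by simp⟩
  refine ⟨A, hA, hcomm, ?_⟩
  obtain ⟨n, hn⟩ := hG.nilpotent'
  suffices h : ∀ n, ∀ c ∈ Subgroup.upperCentralSeries G n,
      c ∈ Subgroup.centralizer (A : Set G) → c ∈ A from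
    fun c hc => h n c (hn ▸ Subgroup.mem_top c) hc
  intro n
  induction n with
  | zero =>
    intro c hc _
    rw [Subgroup.upperCentralSeries_zero, Subgroup.mem_bot] at hc
    exact hc ▸ A.one_mem
  | succ n ih =>
    intro c hc hcA
    rw [Subgroup.mem_upperCentralSeries_succ_iff] at hc
    have hcA' : ∀ a ∈ A, a * c = c * a := Subgroup.mem_centralizer_iff.1 hcA
    have hS : insert c (A : Set G) ⊆ Subgroup.centralizer (insert c (A : Set G)) := by
      rintro s (rfl | hs) <;> rw [SetLike.mem_coe, Subgroup.mem_centralizer_iff] <;>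
        rintro t (rfl | ht)
      · rfl
      · exact hcA' t ht
      · exact (hcA' s hs).symm
      · exact hcomm t ht s hs
    have hB : Subgroup.closure (insert c (A : Set G)) ≤
        Subgroup.centralizer (Subgroup.closure (insert c (A : Set G)) : Set G) := by
      rw [Subgroup.centralizer_closure, Subgroup.closure_le]
      exact hS
    have hAB : A ≤ Subgroup.closure (insert c (A : Set G)) := fun a ha =>
      Subgroup.subset_closure (Set.mem_insert_of_mem _ ha)
    have hcB : c ∈ Subgroup.closure (insert c (A : Set G)) :=
      Subgroup.subset_closure (Set.mem_insert _ _)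
    refine hmax ⟨⟨fun b hb g => ?_⟩, fun a ha b hb => ?_⟩ hAB hcB
    · induction hb using Subgroup.closure_induction with
      | mem x hx =>
        rcases hx with rfl | hx
        -- The commutator lies one level lower in the series and still centralizes `A`, so induction
        -- applies.
        · have h1 : x * g * x⁻¹ * g⁻¹ ∈ A := ih _ (hc g) <| by
            have hN : (Subgroup.centralizer (A : Set G)).Normal := inferInstance
            have := (Subgroup.centralizer (A : Set G)).mul_mem hcA
              (hN.conj_mem _ (inv_mem hcA) g)
            simpa [mul_assoc] using this
          have h2 := mul_mem (hAB (inv_mem h1)) hcB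
          simpa [mul_assoc] using h2
        · exact hAB (hA.conj_mem x hx g)
      | one => simp
      | mul x y _ _ hx hy =>
        have := mul_mem hx hy
        simpa [mul_assoc] using this
      | inv x _ hx =>
        have := inv_mem hx
        simpa [mul_assoc] using this
    · exact Subgroup.mem_centralizer_iff.1 (hB hb) a ha

/-- Commuting with `x` raises powers of `a` to the exponent `Q - 1`, up to inversion, and descends
one step of the upper central series. -/
theorem Group.IsNilpotent.exists_orderOf_dvd_pow {G : Type*} [Group G]
    [hG : Group.IsNilpotent G] {a x : G} {Q : ℕ} (hQ : 0 < Q) (h : x * a * x⁻¹ = a ^ Q) :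
    ∃ c, orderOf a ∣ (Q - 1) ^ c := by
  obtain ⟨n, hn⟩ := hG.nilpotent'
  refine ⟨n, orderOf_dvd_of_pow_eq_one ?_⟩
  suffices H : ∀ n i, a ^ i ∈ Subgroup.upperCentralSeries G n → a ^ (i * (Q - 1) ^ n) = 1 by
    simpa using H n 1 (hn ▸ Subgroup.mem_top _)
  intro n
  induction n with
  | zero => intro i hi; simpa using hi
  | succ n ih =>
    intro i hi
    have h1 := inv_mem (Subgroup.mem_upperCentralSeries_succ_iff.1 hi x)
    have h2 : x * a ^ i * x⁻¹ = a ^ (Q * i) := by rw [← conj_pow, h, pow_mul]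
    have h3 : (a ^ i * x * (a ^ i)⁻¹ * x⁻¹)⁻¹ = a ^ (i * (Q - 1)) := by
      have : (a ^ i * x * (a ^ i)⁻¹ * x⁻¹)⁻¹ = (x * a ^ i * x⁻¹) * (a ^ i)⁻¹ := by group
      rw [this, h2, mul_inv_eq_iff_eq_mul, ← pow_add]
      congr 1
      obtain ⟨q, rfl⟩ := Nat.exists_eq_succ_of_ne_zero hQ.ne'
      simp [Nat.succ_eq_add_one]; ring
    rw [commutatorElement_def, h3] at h1
    have := ih _ h1
    rwa [mul_assoc, ← pow_succ'] at this

/-! ### Primitivity and the field of scalars. -/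

theorem Representation.IsIrreducible.eq_top_of_invariant {F G V : Type*} [Field F] [Group G]
    [AddCommGroup V] [Module F V] {ρ : Representation F G V} (hρ : ρ.IsIrreducible)
    (W : Submodule F V) (hW : ∀ g, ∀ v ∈ W, ρ g v ∈ W) (hne : W ≠ ⊥) : W = ⊤ := by
  have := hρ
  rcases eq_bot_or_eq_top (⟨W, hW⟩ : Subrepresentation ρ) with h | h
  · exact absurd (congrArg Subrepresentation.toSubmodule h) hne
  · exact congrArg Subrepresentation.toSubmodule h

theorem Representation.IsIrreducible.nontrivial {F G V : Type*} [Field F] [Group G]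
    [AddCommGroup V] [Module F V] {ρ : Representation F G V} (hρ : ρ.IsIrreducible) :
    Nontrivial V := by
  have := hρ
  by_contra h
  rw [not_nontrivial_iff_subsingleton] at h
  obtain ⟨a, b, hab⟩ := exists_pair_ne (Subrepresentation ρ)
  apply hab
  cases a
  cases b
  congr 1
  exact Subsingleton.elim _ _

/-- The absence of systems of imprimitivity for a representation. -/
def Representation.HasNoImprimitivity {F G V : Type*} [Field F] [Group G]
    [AddCommGroup V] [Module F V] (ρ : Representation F G V) : Prop :=
  ∀ (k : ℕ) (W : Fin k → Submodule F V), 1 < k → (∀ i, W i ≠ ⊥) → DirectSum.IsInternal W →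
    ¬ ∀ g, ∀ i, ∃ j, (W i).map (ρ g) = W j

theorem Representation.map_torsionBySet_eq {F G R V : Type*} [Field F] [Group G] [CommRing R]
    [Algebra F R] [AddCommGroup V] [Module F V] [Module R V] [IsScalarTower F R V]
    (ρ : Representation F G V) {g : G} (τ : R ≃+* R)
    (hτ : ∀ r v, ρ g (r • v) = τ r • ρ g v) (M : Ideal R) :
    ((Submodule.torsionBySet R V (M : Set R)).restrictScalars F).map (ρ g) =
      (Submodule.torsionBySet R V (M.comap τ.symm : Set R)).restrictScalars F := by
  ext v
  simp only [Submodule.mem_map, Submodule.restrictScalars_mem, Submodule.mem_torsionBySet_iff]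
  constructor
  · rintro ⟨w, hw, rfl⟩ ⟨r, hr⟩
    have h := hτ (τ.symm r) w
    rw [hw ⟨_, hr⟩, map_zero, τ.apply_symm_apply] at h
    exact h.symm
  · intro hv
    refine ⟨ρ g⁻¹ v, fun ⟨r, hr⟩ => ?_, ρ.self_inv_apply g v⟩
    apply (ρ.apply_bijective g).1
    rw [hτ, ρ.self_inv_apply, map_zero]
    exact hv ⟨τ r, by simpa using hr⟩

/-- The torsion submodules of the maximal ideals are independent and permuted by `G`. Irreducibility
makes their sum all of `V`, so two nonzero ones would give a system of imprimitivity. -/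
theorem Representation.exists_isMaximal_smul_eq_zero {F G R V : Type*} [Field F] [Group G]
    [CommRing R] [IsArtinianRing R] [Algebra F R] [AddCommGroup V] [Module F V] [Module R V]
    [IsScalarTower F R V] {ρ : Representation F G V} (hρ : ρ.IsIrreducible)
    (hprim : ρ.HasNoImprimitivity) (τ : G → R ≃+* R)
    (hτ : ∀ g r v, ρ g (r • v) = τ g r • ρ g v) :
    ∃ M : Ideal R, M.IsMaximal ∧ ∀ r ∈ M, ∀ v : V, r • v = 0 := by
  classical
  have := hρ.nontrivial
  set T : MaximalSpectrum R → Submodule R V := fun M =>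
    Submodule.torsionBySet R V (M.asIdeal : Set R) with hT
  have := Fintype.ofFinite (MaximalSpectrum R)
  have hind : iSupIndep T := by
    rw [iSupIndep_iff_supIndep_univ]
    refine Submodule.supIndep_torsionBySet_ideal fun M _ N _ hMN => ?_
    exact Ideal.isCoprime_iff_sup_eq.1
      (Ideal.isCoprime_of_isMaximal (fun h => hMN (MaximalSpectrum.ext h)))
  obtain ⟨act, hact⟩ : ∃ act : G → MaximalSpectrum R → MaximalSpectrum R, ∀ g M,
      ((T M).restrictScalars F).map (ρ g) = (T (act g M)).restrictScalars F :=
    ⟨fun g M => ⟨M.asIdeal.comap (τ g).symm, have := M.isMaximal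
      Ideal.comap_isMaximal_of_equiv (τ g).symm⟩,
      fun g M => ρ.map_torsionBySet_eq (τ g) (hτ g) M.asIdeal⟩
  have hact_ne : ∀ g M, T M ≠ ⊥ → T (act g M) ≠ ⊥ := fun g M hM h => hM <| by
    have h1 := hact g M
    rw [h, Submodule.restrictScalars_bot, ← LinearMap.le_ker_iff_map,
      LinearMap.ker_eq_bot.2 (ρ.apply_bijective g).1, le_bot_iff] at h1
    exact (Submodule.restrictScalars_eq_bot_iff _ _ _).1 h1
  -- An associated prime of `V` is maximal because `R` is Artinian, and it annihilates a nonzero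
  -- vector.
  obtain ⟨M₀, hM₀⟩ : ∃ M, T M ≠ ⊥ := by
    obtain ⟨P, hP⟩ := associatedPrimes.nonempty R V
    obtain ⟨hprime, v, hv⟩ := isAssociatedPrime_iff.1 hP
    refine ⟨⟨P, IsArtinianRing.isMaximal_of_isPrime P⟩, fun h => hprime.ne_top ?_⟩
    have hmem : v ∈ Submodule.torsionBySet R V (P : Set R) := by
      rw [Submodule.mem_torsionBySet_iff]
      rintro ⟨r, hr⟩
      simpa [hv, Submodule.mem_colon_singleton] using hr
    have hv0 : v = 0 := by simpa [hT] using (h.le hmem : v ∈ (⊥ : Submodule R V))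
    rw [hv, hv0, Ideal.eq_top_iff_one, Submodule.mem_colon_singleton, smul_zero]
    exact zero_mem _
  have htop : iSup T = ⊤ := by
    have h := hρ.eq_top_of_invariant ((iSup T).restrictScalars F) (fun g v hv => ?_) (fun h => ?_)
    · exact Submodule.restrictScalars_injective F R V h
    · rw [Submodule.restrictScalars_mem] at hv ⊢
      induction hv using Submodule.iSup_induction' with
      | mem M x hx =>
        have h1 : ρ g x ∈ ((T M).restrictScalars F).map (ρ g) := ⟨x, hx, rfl⟩
        rw [hact] at h1
        exact Submodule.mem_iSup_of_mem _ h1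
      | zero => simp
      | add x y _ _ hx hy => rw [map_add]; exact add_mem hx hy
    · have h0 : iSup T = ⊥ := Submodule.restrictScalars_injective F R V h
      exact hM₀ (le_bot_iff.1 (h0 ▸ le_iSup T M₀))
  let e := Finite.equivFin {M // T M ≠ ⊥}
  let W : Fin (Nat.card {M // T M ≠ ⊥}) → Submodule F V :=
    fun i => (T (e.symm i).1).restrictScalars F
  have hW : DirectSum.IsInternal (fun i => T (e.symm i).1) := by
    rw [DirectSum.isInternal_submodule_iff_iSupIndep_and_iSup_eq_top]
    refine ⟨hind.comp (Subtype.val_injective.comp e.symm.injective), ?_⟩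
    rw [e.symm.iSup_comp (g := fun M : {M // T M ≠ ⊥} => T M.1), eq_top_iff, ← htop]
    refine iSup_le fun M => ?_
    by_cases hM : T M = ⊥
    · simp [hM]
    · exact le_iSup (fun M : {M // T M ≠ ⊥} => T M.1) ⟨M, hM⟩
  have hcard : Nat.card {M // T M ≠ ⊥} ≤ 1 := by
    by_contra! hlt
    refine hprim _ W hlt
      (fun i h => (e.symm i).2 ((Submodule.restrictScalars_eq_bot_iff _ _ _).1 h)) hW fun g i => ?_
    obtain ⟨j, hj⟩ : ∃ j, (e.symm j).1 = act g (e.symm i).1 :=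
      ⟨e ⟨_, hact_ne g _ (e.symm i).2⟩, by rw [e.symm_apply_apply]⟩
    exact ⟨j, (hact g _).trans (by rw [← hj])⟩
  refine ⟨M₀.asIdeal, M₀.isMaximal, fun r hr v => ?_⟩
  have hT₀ : T M₀ = ⊤ := by
    rw [eq_top_iff, ← htop]
    refine iSup_le fun M => ?_
    by_cases hM : T M = ⊥
    · simp [hM]
    · have : Subsingleton {M // T M ≠ ⊥} := (Finite.card_le_one_iff_subsingleton).1 hcard
      have := congrArg Subtype.val (Subsingleton.elim (⟨M, hM⟩ : {M // T M ≠ ⊥}) ⟨M₀, hM₀⟩)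
      exact (congrArg T this).le
  have hv : v ∈ T M₀ := hT₀ ▸ Submodule.mem_top
  exact (Submodule.mem_torsionBySet_iff _ _).1 hv ⟨r, hr⟩

/-- Here `K` is `F[A]` modulo the maximal ideal annihilating `V`; `G` acts on `F[A]` by conjugation
since `A` is normal. -/
theorem Representation.exists_field_of_hasNoImprimitivity.{u, v, w} {F : Type u}
    {G : Type v} {V : Type w} [Field F] [Finite F] [Group G] [Finite G]
    [AddCommGroup V] [Module F V]
    {ρ : Representation F G V} (hρ : ρ.IsIrreducible) (hprim : ρ.HasNoImprimitivity)
    (A : Subgroup G) [hA : A.Normal] (hcomm : ∀ a ∈ A, ∀ b ∈ A, a * b = b * a) :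
    ∃ (K : Type (max u v)) (_ : Field K) (_ : Finite K) (_ : Algebra F K) (_ : Module K V)
      (_ : IsScalarTower F K V) (χ : A →* K),
      (∀ (a : A) v, ρ a v = χ a • v) ∧ Algebra.adjoin F (Set.range χ) = ⊤ := by
  let _ : CommGroup A :=
    { (inferInstance : Group A) with
      mul_comm := fun a b => Subtype.ext (hcomm a a.2 b b.2) }
  have : Finite (MonoidAlgebra F A) := Finite.of_equiv (A → F)
    (Finsupp.equivFunOnFinite.symm.trans MonoidAlgebra.coeffEquiv.symm)
  have : IsArtinianRing (MonoidAlgebra F A) := inferInstance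
  let ρA : Representation F A V := ρ.comp A.subtype
  let _ : Module (MonoidAlgebra F A) V := Module.compHom V ρA.asAlgebraHom.toRingHom
  have hsmul : ∀ (r : MonoidAlgebra F A) (v : V), r • v = ρA.asAlgebraHom r v := fun _ _ => rfl
  have : IsScalarTower F (MonoidAlgebra F A) V := ⟨fun c r v => by
    rw [hsmul, hsmul, map_smul, LinearMap.smul_apply]⟩
  obtain ⟨M, hM, hann⟩ := Representation.exists_isMaximal_smul_eq_zero
    (R := MonoidAlgebra F A) hρ hprim
    (fun g => MonoidAlgebra.mapDomainRingEquiv F (MulAut.conjNormal g)) (fun g r v => by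
      rw [hsmul, hsmul]
      induction r using MonoidAlgebra.induction_linear with
      | zero => simp
      | add r s hr hs => simp only [map_add, LinearMap.add_apply, hr, hs]
      | single a c =>
        have h : ρ g (ρ a v) = ρ (g * a * g⁻¹) (ρ g v) := by
          rw [← Module.End.mul_apply, ← Module.End.mul_apply, ← map_mul, ← map_mul]
          simp
        rw [MonoidAlgebra.mapDomainRingEquiv_single, Representation.asAlgebraHom_single,
          Representation.asAlgebraHom_single, LinearMap.smul_apply, LinearMap.smul_apply, map_smul]
        exact congrArg (c • ·) h)
  have htors : Module.IsTorsionBySet (MonoidAlgebra F A) V (M : Set (MonoidAlgebra F A)) :=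
    fun v r => hann r r.2 v
  let _ : Module (MonoidAlgebra F A ⧸ M) V := htors.module
  refine ⟨MonoidAlgebra F A ⧸ M, Ideal.Quotient.field M,
    Finite.of_surjective _ Ideal.Quotient.mk_surjective, inferInstance,
    htors.module, htors.isScalarTower,
    (Ideal.Quotient.mk M : MonoidAlgebra F A →* _).comp (MonoidAlgebra.of F A), ?_, ?_⟩
  · intro a v
    have : ρ a v = MonoidAlgebra.of F A a • v := by
      rw [hsmul]; simp [ρA]
    rw [this]
    rfl
  · rw [eq_top_iff]
    rintro k -
    obtain ⟨r, rfl⟩ := Ideal.Quotient.mk_surjective k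
    induction r using MonoidAlgebra.induction_linear with
    | zero => rw [map_zero]; exact zero_mem _
    | add r s hr hs => rw [map_add]; exact add_mem hr hs
    | single a c =>
      have : MonoidAlgebra.single a c = c • MonoidAlgebra.of F A a := by simp
      rw [this]
      refine Subalgebra.smul_mem _ (x := Ideal.Quotient.mk M (MonoidAlgebra.of F A a)) ?_ c
      exact Algebra.subset_adjoin (Set.mem_range_self a)

/-! ### Semilinearity and Frobenius. -/

/-- Conjugation by `g` preserves `χ(A)`, which generates `K`; a nonzero vector makes the transformed
scalar unique. -/
theorem Representation.exists_algEquiv_semilinear {F K G V : Type*} [Field F] [Field K]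
    [Finite K] [Algebra F K] [Group G] [AddCommGroup V] [Module F V] [Module K V]
    [IsScalarTower F K V] [Nontrivial V] {ρ : Representation F G V}
    {A : Subgroup G} [hA : A.Normal] {χ : A →* K} (hχ : ∀ (a : A) v, ρ a v = χ a • v)
    (hadj : Algebra.adjoin F (Set.range χ) = ⊤) (g : G) :
    ∃ σ : K ≃ₐ[F] K, ∀ (l : K) v, ρ g (l • v) = σ l • ρ g v := by
  have hex : ∀ l : K, ∃ l' : K, ∀ v, ρ g (l • v) = l' • ρ g v := by
    intro l
    have hl : l ∈ Algebra.adjoin F (Set.range χ) := hadj ▸ Algebra.mem_top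
    induction hl using Algebra.adjoin_induction with
    | mem l hl =>
      obtain ⟨a, rfl⟩ := hl
      refine ⟨χ (MulAut.conjNormal g a), fun v => ?_⟩
      rw [← hχ, ← hχ, ← Module.End.mul_apply, ← Module.End.mul_apply, ← map_mul, ← map_mul]
      simp
    | algebraMap r =>
      exact ⟨algebraMap F K r, fun v => by rw [algebraMap_smul, algebraMap_smul, map_smul]⟩
    | add x y _ _ hx hy =>
      obtain ⟨x', hx⟩ := hx
      obtain ⟨y', hy⟩ := hy
      exact ⟨x' + y', fun v => by rw [add_smul, add_smul, map_add, hx, hy]⟩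
    | mul x y _ _ hx hy =>
      obtain ⟨x', hx⟩ := hx
      obtain ⟨y', hy⟩ := hy
      exact ⟨x' * y', fun v => by rw [mul_smul, mul_smul, hx, hy]⟩
  choose σ hσ using hex
  obtain ⟨v₀, hv₀⟩ := exists_ne (0 : V)
  have hgv₀ : ρ g v₀ ≠ 0 := fun h => hv₀ ((ρ.apply_bijective g).1 (h.trans (map_zero _).symm))
  have huniq : ∀ {l l' : K}, l • ρ g v₀ = l' • ρ g v₀ → l = l' := fun h =>
    smul_left_injective K hgv₀ h
  let f : K →ₐ[F] K :=
    { toFun := σ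
      map_one' := huniq (by rw [← hσ, one_smul, one_smul])
      map_mul' := fun x y => huniq (by rw [← hσ, mul_smul, mul_smul, hσ, hσ])
      map_zero' := huniq (by rw [← hσ, zero_smul, zero_smul, map_zero])
      map_add' := fun x y => huniq (by rw [← hσ, add_smul, add_smul, map_add, hσ, hσ])
      commutes' := fun r => huniq (by
        rw [← hσ, algebraMap_smul, algebraMap_smul, map_smul]) }
  exact ⟨AlgEquiv.ofBijective f (Finite.injective_iff_bijective.1 f.toRingHom.injective), hσ⟩

/-- `Q` is the order of the fixed field of the automorphisms induced by `G`. By the Galois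
correspondence its Frobenius is among them and generates them. -/
theorem Representation.exists_frobenius_generator {F K G V : Type*} [Field F] [Field K]
    [Finite K] [Algebra F K] [Group G] [AddCommGroup V] [Module F V] [Module K V]
    [Finite F] [Nontrivial V]
    {ρ : Representation F G V}
    (hσ : ∀ g, ∃ σ : K ≃ₐ[F] K, ∀ (l : K) v, ρ g (l • v) = σ l • ρ g v) :
    ∃ (x : G) (Q d : ℕ), 1 < Q ∧ d ≠ 0 ∧ Nat.card K = Q ^ d ∧
      (∀ (l : K) v, ρ x (l • v) = l ^ Q • ρ x v) ∧
      ∀ g, ∃ i : ℕ, ∀ (l : K) v, ρ g (l • v) = l ^ Q ^ i • ρ g v := by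
  let Γ : Subgroup Gal(K/F) :=
    { carrier := {σ | ∃ g, ∀ (l : K) v, ρ g (l • v) = σ l • ρ g v}
      one_mem' := ⟨1, by simp⟩
      mul_mem' := by
        rintro σ τ ⟨g, hg⟩ ⟨h, hh⟩
        exact ⟨g * h, fun l v => by simp [hg, hh]⟩
      inv_mem' := by
        rintro σ ⟨g, hg⟩
        refine ⟨g⁻¹, fun l v => (ρ.apply_bijective g).1 ?_⟩
        rw [hg, ρ.self_inv_apply, ρ.self_inv_apply, ← AlgEquiv.mul_apply, mul_inv_cancel,
          AlgEquiv.one_apply] }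
  have : Module.Finite F K := Module.Finite.of_finite
  let L := IntermediateField.fixedField Γ
  have hL : L.fixingSubgroup = Γ := IntermediateField.fixingSubgroup_fixedField Γ
  have := Fintype.ofFinite L
  have hmem : ∀ τ : Gal(K/L), ∃ g, ∀ (l : K) v, ρ g (l • v) = τ l • ρ g v := by
    intro τ
    have h : τ.restrictScalars F ∈ Γ := by
      rw [← hL, IntermediateField.mem_fixingSubgroup_iff]
      exact fun y hy => τ.commutes ⟨y, hy⟩
    exact h
  obtain ⟨x, hx⟩ := hmem (FiniteField.frobeniusAlgEquivOfAlgebraic L K)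
  refine ⟨x, Fintype.card L, Module.finrank L K, Fintype.one_lt_card, Module.finrank_pos.ne', ?_,
    hx, fun g => ?_⟩
  · rw [Module.natCard_eq_pow_finrank (K := L), Fintype.card_eq_nat_card]
  · obtain ⟨σ, hσ⟩ := hσ g
    have hσL : σ ∈ L.fixingSubgroup := hL ▸ ⟨g, hσ⟩
    obtain ⟨i, hi⟩ := (FiniteField.bijective_frobeniusAlgEquivOfAlgebraic_pow L K).2
      (IntermediateField.fixingSubgroupEquiv L ⟨σ, hσL⟩)
    refine ⟨i, fun l v => ?_⟩
    rw [hσ]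
    have h := DFunLike.congr_fun hi l
    have h2 : (IntermediateField.fixingSubgroupEquiv L ⟨σ, hσL⟩) l = σ l := rfl
    rw [h2] at h
    rw [← h, AlgEquiv.coe_pow, FiniteField.coe_frobeniusAlgEquivOfAlgebraic_iterate]

/-! ### Eigenvectors of semilinear maps. -/

theorem Module.End.pow_apply_smul_of_semilinear {F K V : Type*} [Field F] [Field K]
    [AddCommGroup V] [Module F V] [Module K V]
    {T : Module.End F V} {Q : ℕ}
    (hT : ∀ (l : K) v, T (l • v) = l ^ Q • T v) (i : ℕ) (l : K) (v : V) :
    (T ^ i) (l • v) = l ^ Q ^ i • (T ^ i) v := by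
  induction i with
  | zero => simp
  | succ i ih => rw [pow_succ', Module.End.mul_apply, ih, hT, Module.End.mul_apply, ← pow_mul,
      ← pow_succ]

theorem Module.End.pow_apply_of_semilinear_eigenvector {F K V : Type*} [Field F] [Field K]
    [AddCommGroup V] [Module F V] [Module K V]
    {T : Module.End F V} {Q : ℕ}
    (hT : ∀ (l : K) v, T (l • v) = l ^ Q • T v) {γ : K} {v : V} (hv : T v = γ • v) (i : ℕ) :
    (T ^ i) v = γ ^ (∑ j ∈ Finset.range i, Q ^ j) • v := by
  induction i with
  | zero => simp
  | succ i ih =>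
    rw [pow_succ, Module.End.mul_apply, hv, pow_apply_smul_of_semilinear hT, ih, ← mul_smul,
      ← pow_add, Finset.sum_range_succ, add_comm]

theorem Nat.card_units_eq_geom_sum_mul {K : Type*} [Field K] {Q d : ℕ} (hQ : 1 < Q)
    (hcard : Nat.card K = Q ^ d) :
    Nat.card Kˣ = (∑ i ∈ Finset.range d, Q ^ i) * (Q - 1) := by
  rw [geom_sum_mul_of_one_le hQ.le, Nat.card_units, hcard]

/-- After applying a functional, the sum is a polynomial in `l` of degree at most `Q ^ (d - 1) <
Nat.card K`, with nonzero linear coefficient. -/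
theorem exists_sum_smul_pow_ne_zero {K V : Type*} [Field K] [Finite K] [AddCommGroup V]
    [Module K V] {Q d : ℕ} (hQ : 1 < Q) (hcard : Nat.card K = Q ^ d)
    (hd : d ≠ 0) (u : ℕ → V) (hu : u 0 ≠ 0) :
    ∃ l : K, ∑ i ∈ Finset.range d, l ^ Q ^ i • u i ≠ 0 := by
  by_contra! h
  obtain ⟨f, hf⟩ : ∃ f : Module.Dual K V, f (u 0) ≠ 0 := by
    by_contra! h0
    exact hu ((Module.forall_dual_apply_eq_zero_iff K _).1 h0)
  let p : Polynomial K := ∑ i ∈ Finset.range d, Polynomial.C (f (u i)) * Polynomial.X ^ Q ^ i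
  have := Fintype.ofFinite K
  have hp : p = 0 := by
    refine Polynomial.eq_zero_of_natDegree_lt_card_of_eval_eq_zero p (f := id)
      Function.injective_id (fun l => ?_) ?_
    · have h1 := congrArg f (h l)
      simp only [map_sum, map_smul, smul_eq_mul, map_zero] at h1
      rw [← h1, Polynomial.eval_finsetSum]
      refine Finset.sum_congr rfl fun i _ => ?_
      rw [Polynomial.eval_mul, Polynomial.eval_C, Polynomial.eval_pow, Polynomial.eval_X, mul_comm]
      rfl
    · rw [Fintype.card_eq_nat_card, hcard]
      refine lt_of_le_of_lt (Polynomial.natDegree_sum_le_of_forall_le (n := Q ^ (d - 1)) _ _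
        fun i hi => ?_) (Nat.pow_lt_pow_right hQ (by omega))
      refine (Polynomial.natDegree_C_mul_X_pow_le _ _).trans
        (Nat.pow_le_pow_right (by omega) ?_)
      have := Finset.mem_range.1 hi
      omega
  have h1 : p.coeff 1 = f (u 0) := by
    simp only [p, Polynomial.finsetSum_coeff, Polynomial.coeff_C_mul_X_pow]
    rw [Finset.sum_eq_single 0]
    · simp
    · intro i _ hi
      rw [if_neg]
      exact (Nat.one_lt_pow hi hQ).ne
    · intro h
      simp [hd] at h
  rw [hp, Polynomial.coeff_zero] at h1
  exact hf h1.symm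

/-- Hilbert 90: `β` is the norm of some `γ`, and a nonvanishing Lagrange resolvent for `γ⁻¹ T` is an
eigenvector. -/
theorem Module.End.exists_semilinear_eigenvector {F K V : Type*} [Field F] [Field K]
    [AddCommGroup V] [Module F V] [Module K V]
    [Finite K] [Nontrivial V] {T : Module.End F V} {Q d : ℕ}
    (hQ : 1 < Q) (hd : d ≠ 0) (hcard : Nat.card K = Q ^ d)
    (hT : ∀ (l : K) v, T (l • v) = l ^ Q • T v) {β : Kˣ} (hTd : ∀ v, (T ^ d) v = β • v) :
    ∃ v ≠ 0, ∃ γ : K, T v = γ • v := by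
  obtain ⟨w, hw⟩ := exists_ne (0 : V)
  -- `T` commutes with `T ^ d = β`, so `β` is fixed by the `Q`-power map.
  have hβ : β ^ (Q - 1) = 1 := by
    have hTw : T w ≠ 0 := by
      intro h
      have h1 := hTd w
      obtain ⟨e, rfl⟩ := Nat.exists_eq_succ_of_ne_zero hd
      rw [Nat.succ_eq_add_one, pow_succ, Module.End.mul_apply, h, map_zero, eq_comm,
        smul_eq_zero_iff_eq] at h1
      exact hw h1
    have h1 : T ((T ^ d) w) = (T ^ d) (T w) := by
      rw [← Module.End.mul_apply, ← Module.End.mul_apply, ← pow_succ, ← pow_succ']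
    rw [hTd, hTd, Units.smul_def, Units.smul_def, hT] at h1
    have h2 : β ^ Q = β := Units.ext (by simpa using smul_left_injective K hTw h1)
    obtain ⟨q, rfl⟩ := Nat.exists_eq_succ_of_ne_zero (show Q ≠ 0 by omega)
    rw [Nat.succ_eq_add_one, pow_succ] at h2
    simpa using h2
  obtain ⟨γ, hγ⟩ := IsCyclic.exists_pow_eq_of_pow_eq_one
    ((Nat.card_units_eq_geom_sum_mul hQ hcard).trans (mul_comm _ _)) hβ
  let c : ℕ → Kˣ := fun i => (γ ^ (∑ j ∈ Finset.range i, Q ^ j))⁻¹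
  have hc : ∀ i, (c i) ^ Q = γ * c (i + 1) := by
    intro i
    have h : (∑ j ∈ Finset.range (i + 1), Q ^ j) = (∑ j ∈ Finset.range i, Q ^ j) * Q + 1 := by
      rw [Finset.sum_range_succ', Finset.sum_mul]
      simp [pow_succ]
    simp only [c, h]
    rw [inv_pow, ← pow_mul, pow_succ, mul_inv]
    simp
  obtain ⟨l, hl⟩ := exists_sum_smul_pow_ne_zero hQ hcard hd
    (fun i => (c i : K) • (T ^ i) w) (by simpa [c] using hw)
  refine ⟨_, hl, γ, ?_⟩
  have hstep : ∀ i, T (l ^ Q ^ i • (c i : K) • (T ^ i) w) =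
      (γ : K) • (l ^ Q ^ (i + 1) • (c (i + 1) : K) • (T ^ (i + 1)) w) := by
    intro i
    have hci : ((c i : K)) ^ Q = γ * c (i + 1) := by exact_mod_cast congrArg Units.val (hc i)
    rw [hT, hT, hci, ← pow_mul, ← pow_succ, pow_succ' T, Module.End.mul_apply, mul_smul,
      smul_comm (l ^ _)]
  rw [map_sum, Finset.sum_congr rfl fun i _ => hstep i, ← Finset.smul_sum]
  congr 1
  have h0 := Finset.sum_range_succ' (fun i => l ^ Q ^ i • (c i : K) • (T ^ i) w) d
  rw [Finset.sum_range_succ] at h0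
  -- The resolvent closes up: its term at `d` equals its term at `0`, so shifting the index leaves
  -- the sum unchanged.
  have hlast : l ^ Q ^ d • (c d : K) • (T ^ d) w = l ^ Q ^ 0 • (c 0 : K) • (T ^ 0) w := by
    have := Fintype.ofFinite K
    have hl : l ^ Q ^ d = l := by
      rw [← hcard, ← Fintype.card_eq_nat_card]; exact FiniteField.pow_card l
    have hcd : c d = β⁻¹ := by simp only [c, hγ]
    rw [hl, hTd, hcd, ← Units.smul_def, inv_smul_smul]
    simp [c]
  rw [hlast] at h0
  exact (add_right_cancel h0).symm

/-! ### Groups with a self-centralizing subgroup of scalars. -/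

/-- A subgroup `A` acts on `V` through scalars of a field `K`, and these scalars generate `K`. -/
structure Representation.IsScalarOn {F K G V : Type*} [Field F] [Field K] [Algebra F K] [Group G]
    [AddCommGroup V] [Module F V] [Module K V] (ρ : Representation F G V) (A : Subgroup G)
    (χ : A →* K) : Prop where
  apply_eq : ∀ (a : A) v, ρ a v = χ a • v
  adjoin_eq_top : Algebra.adjoin F (Set.range χ) = ⊤

namespace Representation.IsScalarOn

variable {F K G V : Type*} [Field F] [Field K] [Algebra F K] [Group G]
  [AddCommGroup V] [Module F V] [Module K V] {ρ : Representation F G V} {A : Subgroup G}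
  {χ : A →* K}

theorem injective (h : ρ.IsScalarOn A χ) (hinj : Function.Injective ρ) : Function.Injective χ := by
  intro a b hab
  refine Subtype.ext (hinj (LinearMap.ext fun v => ?_))
  rw [h.apply_eq, h.apply_eq, hab]

theorem mem_of_linear (h : ρ.IsScalarOn A χ) (hinj : Function.Injective ρ)
    (hcent : Subgroup.centralizer (A : Set G) ≤ A) {g : G}
    (hg : ∀ (l : K) v, ρ g (l • v) = l • ρ g v) : g ∈ A := by
  refine hcent (Subgroup.mem_centralizer_iff.2 fun a ha => hinj (LinearMap.ext fun v => ?_))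
  rw [map_mul, map_mul, Module.End.mul_apply, Module.End.mul_apply, h.apply_eq ⟨a, ha⟩,
    h.apply_eq ⟨a, ha⟩, hg]

theorem pow_mem (h : ρ.IsScalarOn A χ) (hinj : Function.Injective ρ) [Finite K]
    (hcent : Subgroup.centralizer (A : Set G) ≤ A) {x : G} {Q d : ℕ}
    (hcard : Nat.card K = Q ^ d) (hx : ∀ (l : K) v, ρ x (l • v) = l ^ Q • ρ x v) : x ^ d ∈ A := by
  refine h.mem_of_linear hinj hcent fun l v => ?_
  rw [map_pow, Module.End.pow_apply_smul_of_semilinear hx, ← hcard]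
  have := Fintype.ofFinite K
  rw [← Fintype.card_eq_nat_card, FiniteField.pow_card]

theorem exists_eq_pow_mul (h : ρ.IsScalarOn A χ) (hinj : Function.Injective ρ)
    (hcent : Subgroup.centralizer (A : Set G) ≤ A) {x : G} {Q : ℕ}
    (hx : ∀ (l : K) v, ρ x (l • v) = l ^ Q • ρ x v)
    {g : G} {i : ℕ} (hg : ∀ (l : K) v, ρ g (l • v) = l ^ Q ^ i • ρ g v) :
    ∃ a ∈ A, g = x ^ i * a := by
  refine ⟨(x ^ i)⁻¹ * g, h.mem_of_linear hinj hcent fun l v => (ρ.apply_bijective (x ^ i)).1 ?_,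
    by group⟩
  rw [map_mul, Module.End.mul_apply, Module.End.mul_apply, ρ.self_inv_apply, hg, map_pow,
    Module.End.pow_apply_smul_of_semilinear hx, ← map_pow, ρ.self_inv_apply]

/-- `G` is generated by scalars and `x`, so the `K`-line through an eigenvector of `x` is invariant,
and irreducibility makes it all of `V`. -/
theorem exists_forall_eq_smul [Finite F] [Finite K] [IsScalarTower F K V]
    (h : ρ.IsScalarOn A χ) (hρ : ρ.IsIrreducible)
    (hinj : Function.Injective ρ) (hA : A.Normal)
    (hcent : Subgroup.centralizer (A : Set G) ≤ A) :
    ∃ v : V, v ≠ 0 ∧ ∀ w, ∃ l : K, w = l • v := by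
  have := hρ.nontrivial
  obtain ⟨x, Q, d, hQ, hd, hcard, hx, hG⟩ := Representation.exists_frobenius_generator
    (Representation.exists_algEquiv_semilinear h.apply_eq h.adjoin_eq_top)
  have hxd := h.pow_mem hinj hcent hcard hx
  obtain ⟨v, hv, γ, hγ⟩ := Module.End.exists_semilinear_eigenvector hQ hd hcard hx
    (β := χ.toHomUnits ⟨x ^ d, hxd⟩) (fun v => by
      rw [← map_pow, h.apply_eq ⟨x ^ d, hxd⟩]; rfl)
  refine ⟨v, hv, ?_⟩
  have htop := hρ.eq_top_of_invariant ((K ∙ v).restrictScalars F) (fun g w hw => ?_) (fun hbot => ?_)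
  · intro w
    have hw : w ∈ (K ∙ v).restrictScalars F := htop ▸ Submodule.mem_top
    obtain ⟨l, hl⟩ := Submodule.mem_span_singleton.1 hw
    exact ⟨l, hl.symm⟩
  · rw [Submodule.restrictScalars_mem] at hw ⊢
    obtain ⟨l, rfl⟩ := Submodule.mem_span_singleton.1 hw
    obtain ⟨i, hi⟩ := hG g
    obtain ⟨a, ha, rfl⟩ := h.exists_eq_pow_mul hinj hcent hx hi
    rw [hi, map_mul, Module.End.mul_apply, h.apply_eq ⟨a, ha⟩, map_pow,
      Module.End.pow_apply_smul_of_semilinear hx,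
      Module.End.pow_apply_of_semilinear_eigenvector hx hγ]
    exact Submodule.smul_mem _ _ (Submodule.smul_mem _ _ (Submodule.smul_mem _ _
      (Submodule.mem_span_singleton_self v)))
  · rw [Submodule.restrictScalars_eq_bot_iff, Submodule.span_singleton_eq_bot] at hbot
    exact hv hbot

theorem conj_eq_pow (h : ρ.IsScalarOn A χ) (hinj : Function.Injective ρ) {x a : G} (ha : a ∈ A)
    {Q : ℕ} (hx : ∀ (l : K) v, ρ x (l • v) = l ^ Q • ρ x v) : x * a * x⁻¹ = a ^ Q := by
  rw [mul_inv_eq_iff_eq_mul]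
  refine hinj (LinearMap.ext fun v => ?_)
  have hQ := h.apply_eq (⟨a, ha⟩ ^ Q) (ρ x v)
  rw [map_pow] at hQ
  rw [map_mul, map_mul, Module.End.mul_apply, Module.End.mul_apply, h.apply_eq ⟨a, ha⟩, hx, ← hQ]
  rfl

/-- The automorphism induced by `x` is determined on `χ(A)` by conjugation in `G`. Thus one
representation's Frobenius exponent carries over to another. -/
theorem apply_smul_of_conj_eq_pow [Finite K] [IsScalarTower F K V] [Nontrivial V]
    (h : ρ.IsScalarOn A χ) (hA : A.Normal) {x : G} {Q : ℕ}
    (hx : ∀ a ∈ A, x * a * x⁻¹ = a ^ Q) (τ : K ≃ₐ[F] K) (hτ : ∀ l, τ l = l ^ Q) (l : K) (v : V) :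
    ρ x (l • v) = l ^ Q • ρ x v := by
  obtain ⟨σ, hσ⟩ := Representation.exists_algEquiv_semilinear h.apply_eq h.adjoin_eq_top x
  obtain ⟨v₀, hv₀⟩ := exists_ne (0 : V)
  have hxv₀ : ρ x v₀ ≠ 0 := fun h => hv₀ ((ρ.apply_bijective x).1 (h.trans (map_zero _).symm))
  have hστ : (σ : K →ₐ[F] K) = τ := by
    refine AlgHom.ext_of_adjoin_eq_top h.adjoin_eq_top ?_
    rintro _ ⟨a, rfl⟩
    refine smul_left_injective K hxv₀ ?_
    have hxa := hx a a.2
    rw [mul_inv_eq_iff_eq_mul] at hxa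
    have h1 := LinearMap.congr_fun (congrArg ρ hxa) v₀
    have hQ := h.apply_eq (a ^ Q) (ρ x v₀)
    rw [map_pow] at hQ
    rw [map_mul, map_mul, Module.End.mul_apply, Module.End.mul_apply, h.apply_eq, hσ] at h1
    change σ (χ a) • ρ x v₀ = τ (χ a) • ρ x v₀
    rw [h1, hτ, ← hQ]
    rfl
  rw [hσ, ← hτ]
  exact congrArg (· • ρ x v) (DFunLike.congr_fun hστ l)

/-- Otherwise `τ ^ e` fixes `χ(A)`, hence all of `K`, and the cyclic group `Kˣ` of order `Q ^ d - 1`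
has exponent dividing `Q ^ e - 1`. -/
theorem not_dvd_of_lt (h : ρ.IsScalarOn A χ) [Finite K] {a : G}
    (hgen : ∀ b ∈ A, ∃ i : ℕ, b = a ^ i) {Q d e : ℕ} (hQ : 1 < Q)
    (hcard : Nat.card K = Q ^ d) (τ : K ≃ₐ[F] K) (hτ : ∀ l, τ l = l ^ Q) (he : 0 < e)
    (hed : e < d) : ¬ orderOf a ∣ Q ^ e - 1 := by
  intro hdvd
  have hpow : ∀ i l, (τ ^ i) l = l ^ Q ^ i := by
    intro i
    induction i with
    | zero => simp
    | succ i ih => intro l; rw [pow_succ', AlgEquiv.mul_apply, ih, hτ, ← pow_mul, ← pow_succ]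
  have ha1 : a ^ Q ^ e = a := by
    have h1 := orderOf_dvd_iff_pow_eq_one.1 hdvd
    have h2 : Q ^ e = (Q ^ e - 1) + 1 := by
      have := Nat.one_le_pow e Q (by omega)
      omega
    rw [h2, pow_succ, h1, one_mul]
  have hfix : ((τ ^ e : K ≃ₐ[F] K) : K →ₐ[F] K) = AlgHom.id F K := by
    refine AlgHom.ext_of_adjoin_eq_top h.adjoin_eq_top ?_
    rintro _ ⟨b, rfl⟩
    change (τ ^ e) (χ b) = χ b
    rw [hpow, ← map_pow]
    congr 1
    obtain ⟨i, hi⟩ := hgen b b.2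
    refine Subtype.ext ?_
    change (b : G) ^ Q ^ e = b
    rw [hi, ← pow_mul, mul_comm, pow_mul, ha1]
  have hall : ∀ u : Kˣ, u ^ (Q ^ e - 1) = 1 := by
    intro u
    have h1 : (u : K) ^ Q ^ e = u := (hpow e u).symm.trans (DFunLike.congr_fun hfix (u : K))
    have h2 : Q ^ e = (Q ^ e - 1) + 1 := by
      have := Nat.one_le_pow e Q (by omega)
      omega
    rw [h2, pow_succ] at h1
    exact Units.ext (by simpa using h1)
  have hdvd' : Nat.card Kˣ ∣ Q ^ e - 1 := by
    rw [← IsCyclic.exponent_eq_card]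
    exact Monoid.exponent_dvd_of_forall_pow_eq_one hall
  rw [Nat.card_units, hcard] at hdvd'
  have h1 := Nat.le_of_dvd (Nat.sub_pos_of_lt (Nat.one_lt_pow he.ne' hQ)) hdvd'
  have h2 := Nat.pow_lt_pow_right hQ hed
  have h3 := Nat.one_le_pow e Q (by omega)
  omega

end Representation.IsScalarOn

/-! ### Comparison of two one-dimensional semilinear representations. -/

/-- Choosing `z` to match norms makes `γ' / (γ * ζ ^ z)` an element of norm one, hence a `(Q -
1)`-th power. -/
theorem FiniteField.exists_eq_mul_zpow_mul_pow {K : Type*} [Field K] [Finite K] {Q d s k : ℕ}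
    {ζ γ γ' : Kˣ} (hQ : 1 < Q) (hd : d ≠ 0) (hcard : Nat.card K = Q ^ d)
    (hprime : ∀ l : ℕ, l.Prime → l ∣ orderOf ζ → l ∣ Q - 1)
    (hmin : ∀ e, 0 < e → e < d → ¬ orderOf ζ ∣ Q ^ e - 1) (hk : k.Coprime (orderOf ζ))
    (hγ : γ ^ (∑ i ∈ Finset.range d, Q ^ i) = ζ ^ s)
    (hγ' : γ' ^ (∑ i ∈ Finset.range d, Q ^ i) = ζ ^ (s * k)) :
    ∃ (z : ℤ) (t : Kˣ), γ' = γ * ζ ^ z * t ^ (Q - 1) := by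
  have hcardu := Nat.card_units_eq_geom_sum_mul hQ hcard
  have hdm : orderOf ζ ∣ Q ^ d - 1 := by
    rw [← hcard, ← Nat.card_units]; exact orderOf_dvd_natCard ζ
  have hb : orderOf ζ ∣ s * (Q - 1) := by
    apply orderOf_dvd_of_pow_eq_one
    rw [pow_mul, ← hγ, ← pow_mul, ← hcardu, pow_card_eq_one']
  -- Only `k` modulo `orderOf ζ` matters; positivity makes the truncated `k - 1` a true difference.
  wlog hk0 : 1 ≤ k generalizing k
  · refine this (k := k + orderOf ζ) (by simpa using hk) ?_ ?_
    · rw [hγ', mul_add, pow_add, mul_comm s (orderOf ζ), pow_mul ζ (orderOf ζ),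
        pow_orderOf_eq_one, one_pow, mul_one]
    · have := orderOf_pos ζ
      omega
  obtain ⟨z, hz⟩ := exists_zpow_pow_eq_of_gcd_dvd
    (gcd_geom_sum_dvd hQ (orderOf_pos ζ).ne' hprime hd hdm hmin hb hk)
  have hone : (γ' / (γ * ζ ^ z)) ^ (∑ i ∈ Finset.range d, Q ^ i) = 1 := by
    rw [div_pow, mul_pow, hz, hγ, hγ', ← pow_add, div_eq_one]
    congr 1
    obtain ⟨j, rfl⟩ := Nat.exists_eq_add_of_le' hk0
    simp only [Nat.add_sub_cancel]
    ring
  obtain ⟨t, ht⟩ := IsCyclic.exists_pow_eq_of_pow_eq_one hcardu hone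
  exact ⟨z, t, by rw [ht, mul_div_cancel]⟩

theorem FiniteField.nonempty_algEquiv_of_natCard_eq (F K L : Type*) [Field F] [Field K] [Field L]
    [Finite K] [Finite L] [Algebra F K] [Algebra F L] (h : Nat.card K = Nat.card L) :
    Nonempty (K ≃ₐ[F] L) := by
  have := Fintype.ofFinite K
  have := Fintype.ofFinite L
  have hK := FiniteField.isSplittingField_sub K F
  have hL := FiniteField.isSplittingField_sub L F
  rw [Fintype.card_eq_nat_card, ← h, ← Fintype.card_eq_nat_card] at hL
  exact ⟨(Polynomial.IsSplittingField.algEquiv K (Polynomial.X ^ Fintype.card K - Polynomial.X)).trans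
    (Polynomial.IsSplittingField.algEquiv L (Polynomial.X ^ Fintype.card K - Polynomial.X)).symm⟩

/-- The coordinate of a one-dimensional `K`-space, as a linear equivalence over a subfield. -/
noncomputable def LinearEquiv.ofGenerator (F : Type*) {K V : Type*} [Field F] [Field K]
    [Algebra F K] [AddCommGroup V] [Module F V] [Module K V] [IsScalarTower F K V] {v : V} (hv : v ≠ 0)
    (hgen : ∀ w, ∃ l : K, w = l • v) : K ≃ₗ[F] V :=
  LinearEquiv.ofBijective ((LinearMap.toSpanSingleton K V v).restrictScalars F)
    ⟨smul_left_injective K hv, fun w => (hgen w).imp fun _ h => h.symm⟩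

namespace Representation.IsScalarOn

variable {F K₁ K₂ G V₁ V₂ : Type*} [Field F] [Finite F] [Field K₁] [Finite K₁] [Algebra F K₁]
  [Field K₂] [Finite K₂] [Algebra F K₂] [Group G]
  [AddCommGroup V₁] [Module F V₁] [Module K₁ V₁] [IsScalarTower F K₁ V₁]
  [AddCommGroup V₂] [Module F V₂] [Module K₂ V₂] [IsScalarTower F K₂ V₂]

theorem exists_intertwining_up_to_image [hG : Group.IsNilpotent G] [Finite G]
    {ρ₁ : Representation F G V₁} {ρ₂ : Representation F G V₂} {A : Subgroup G}
    {χ₁ : A →* K₁} {χ₂ : A →* K₂} (h₁ : ρ₁.IsScalarOn A χ₁) (h₂ : ρ₂.IsScalarOn A χ₂)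
    (hirr₁ : ρ₁.IsIrreducible) (hirr₂ : ρ₂.IsIrreducible)
    (hinj₁ : Function.Injective ρ₁) (hinj₂ : Function.Injective ρ₂) (hA : A.Normal)
    (hcent : Subgroup.centralizer (A : Set G) ≤ A) (hV : Nat.card V₁ = Nat.card V₂) :
    ∃ θ : V₁ ≃ₗ[F] V₂, ∀ g, ∃ g', ∀ v, θ (ρ₁ g v) = ρ₂ g' (θ v) := by
  have := hirr₁.nontrivial
  have := hirr₂.nontrivial
  obtain ⟨v, hv, hgenv⟩ := h₁.exists_forall_eq_smul hirr₁ hinj₁ hA hcent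
  obtain ⟨w, hw, hgenw⟩ := h₂.exists_forall_eq_smul hirr₂ hinj₂ hA hcent
  let e₁ := LinearEquiv.ofGenerator F hv hgenv
  let e₂ := LinearEquiv.ofGenerator F hw hgenw
  have hK : Nat.card K₁ = Nat.card K₂ := by
    rw [Nat.card_congr e₁.toEquiv, Nat.card_congr e₂.toEquiv, hV]
  obtain ⟨ψ⟩ := FiniteField.nonempty_algEquiv_of_natCard_eq F K₁ K₂ hK
  obtain ⟨x, Q, d, hQ, hd, hcard, hx, hgen⟩ := Representation.exists_frobenius_generator
    (Representation.exists_algEquiv_semilinear h₁.apply_eq h₁.adjoin_eq_top)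
  obtain ⟨τ, hτ⟩ : ∃ τ : K₁ ≃ₐ[F] K₁, ∀ l, τ l = l ^ Q := by
    obtain ⟨τ, hτ⟩ := Representation.exists_algEquiv_semilinear h₁.apply_eq h₁.adjoin_eq_top x
    have hxv : ρ₁ x v ≠ 0 := fun h => hv ((ρ₁.apply_bijective x).1 (h.trans (map_zero _).symm))
    exact ⟨τ, fun l => smul_left_injective K₁ hxv ((hτ l v).symm.trans (hx l v))⟩
  have hx₂ : ∀ (l : K₂) u, ρ₂ x (l • u) = l ^ Q • ρ₂ x u :=
    h₂.apply_smul_of_conj_eq_pow hA (fun a ha => h₁.conj_eq_pow hinj₁ ha hx)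
      ((ψ.symm.trans τ).trans ψ) (fun l => by simp [hτ])
  have hcyc : IsCyclic A := isCyclic_of_injective_ringHom χ₁ (h₁.injective hinj₁)
  obtain ⟨a, ha⟩ := IsCyclic.exists_monoid_generator (α := A)
  have hgenA : ∀ b ∈ A, ∃ i : ℕ, b = (a : G) ^ i := fun b hb => by
    obtain ⟨i, hi⟩ := Submonoid.mem_powers_iff _ _ |>.1 (ha ⟨b, hb⟩)
    exact ⟨i, by rw [← Subgroup.coe_pow, hi]⟩
  let ζ₁ := χ₁.toHomUnits a
  let ζ₂ := χ₂.toHomUnits a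
  let Ψ : K₁ˣ ≃* K₂ˣ := Units.mapEquiv ψ.toMulEquiv
  have hinju₁ : Function.Injective χ₁.toHomUnits := fun b c h =>
    h₁.injective hinj₁ (congrArg Units.val h)
  have hinju₂ : Function.Injective χ₂.toHomUnits := fun b c h =>
    h₂.injective hinj₂ (congrArg Units.val h)
  have ho₁ : orderOf ζ₁ = orderOf (a : G) :=
    (orderOf_injective _ hinju₁ a).trans (Subgroup.orderOf_coe a).symm
  have ho₂ : orderOf ζ₂ = orderOf (a : G) :=
    (orderOf_injective _ hinju₂ a).trans (Subgroup.orderOf_coe a).symm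
  have hoψ : orderOf (Ψ ζ₁) = orderOf (a : G) := (orderOf_injective _ Ψ.injective ζ₁).trans ho₁
  have hne : NeZero (orderOf (a : G)) := ⟨(orderOf_pos _).ne'⟩
  have hp₂ : IsPrimitiveRoot (ζ₂ : K₂) (orderOf (a : G)) :=
    IsPrimitiveRoot.coe_units_iff.2 (ho₂ ▸ IsPrimitiveRoot.orderOf ζ₂)
  have hpψ : IsPrimitiveRoot (Ψ ζ₁ : K₂) (orderOf (a : G)) :=
    IsPrimitiveRoot.coe_units_iff.2 (hoψ ▸ IsPrimitiveRoot.orderOf (Ψ ζ₁))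
  -- Both are primitive roots of unity of the same order in `K₂`, so each is a power of the other;
  -- `k` need not come from a field automorphism.
  obtain ⟨k, hk, hkζ⟩ : ∃ k : ℕ, k.Coprime (orderOf (a : G)) ∧ Ψ ζ₁ ^ k = ζ₂ := by
    obtain ⟨k, -, hk, hkζ⟩ := hpψ.isPrimitiveRoot_iff.1 hp₂
    exact ⟨k, hk, Units.ext (by simpa using hkζ)⟩
  obtain ⟨j, hjζ⟩ : ∃ j : ℕ, ζ₂ ^ j = Ψ ζ₁ := by
    obtain ⟨j, -, -, hjζ⟩ := hp₂.isPrimitiveRoot_iff.1 hpψ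
    exact ⟨j, Units.ext (by simpa using hjζ)⟩
  have heig₁ : ∃ γ : K₁ˣ, ρ₁ x v = (γ : K₁) • v := by
    obtain ⟨γ, hγ⟩ := hgenv (ρ₁ x v)
    refine ⟨Units.mk0 γ ?_, hγ⟩
    rintro rfl
    exact hv ((ρ₁.apply_bijective x).1 (by rw [hγ, zero_smul, map_zero]))
  have heig₂ : ∃ γ : K₂ˣ, ρ₂ x w = (γ : K₂) • w := by
    obtain ⟨γ, hγ⟩ := hgenw (ρ₂ x w)
    refine ⟨Units.mk0 γ ?_, hγ⟩
    rintro rfl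
    exact hw ((ρ₂.apply_bijective x).1 (by rw [hγ, zero_smul, map_zero]))
  obtain ⟨γ, hγ⟩ := heig₁
  obtain ⟨γ', hγ'⟩ := heig₂
  have hxd := h₁.pow_mem hinj₁ hcent hcard hx
  obtain ⟨s, hs⟩ := hgenA _ hxd
  have hpow₁ : γ ^ (∑ i ∈ Finset.range d, Q ^ i) = ζ₁ ^ s := by
    have h1 := Module.End.pow_apply_of_semilinear_eigenvector hx hγ d
    rw [← map_pow, hs, ← Subgroup.coe_pow, h₁.apply_eq, map_pow] at h1
    exact Units.ext (by push_cast; exact (smul_left_injective K₁ hv h1).symm)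
  have hpow₂ : γ' ^ (∑ i ∈ Finset.range d, Q ^ i) = ζ₂ ^ s := by
    have h1 := Module.End.pow_apply_of_semilinear_eigenvector hx₂ hγ' d
    rw [← map_pow, hs, ← Subgroup.coe_pow, h₂.apply_eq, map_pow] at h1
    exact Units.ext (by push_cast; exact (smul_left_injective K₂ hw h1).symm)
  obtain ⟨c, hc⟩ := Group.IsNilpotent.exists_orderOf_dvd_pow (by omega)
    (h₁.conj_eq_pow hinj₁ a.2 hx)
  obtain ⟨z, t, hzt⟩ := FiniteField.exists_eq_mul_zpow_mul_pow (γ' := Ψ.symm γ') hQ hd hcard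
    (fun l hl hlm => hl.dvd_of_dvd_pow (hlm.trans (ho₁ ▸ hc)))
    (fun e he hed => ho₁ ▸ h₁.not_dvd_of_lt hgenA hQ hcard τ hτ he hed) (ho₁ ▸ hk) hpow₁ <| by
      rw [← map_pow, hpow₂, ← hkζ, ← pow_mul, ← map_pow, Ψ.symm_apply_apply, mul_comm]
  -- Multiplication by `t⁻¹` removes the factor `t ^ (Q - 1)`, because `(t⁻¹) ^ Q * t ^ (Q - 1) =
  -- t⁻¹`.
  let et : K₁ ≃ₗ[F] K₁ := LinearEquiv.ofGenerator F (K := K₁) (v := ((t⁻¹ : K₁ˣ) : K₁))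
    (Units.ne_zero _) (fun l => ⟨l * t, by simp⟩)
  let θ : V₁ ≃ₗ[F] V₂ := e₁.symm.trans (et.trans (ψ.toLinearEquiv.trans e₂))
  have hθ : ∀ l : K₁, θ (l • v) = ψ (l * (t⁻¹ : K₁ˣ)) • w := by
    intro l
    have h1 : e₁.symm (l • v) = l := by
      rw [LinearEquiv.symm_apply_eq]; rfl
    change e₂ (ψ (et (e₁.symm (l • v)))) = _
    rw [h1]
    rfl
  have hθsmul : ∀ (l : K₁) u, θ (l • u) = ψ l • θ u := by
    intro l u
    obtain ⟨l', rfl⟩ := hgenv u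
    rw [smul_smul, hθ, hθ, smul_smul, ← map_mul, mul_assoc]
  have hρ₂a : ∀ (i : ℤ) u, ρ₂ ((a : G) ^ (j * i)) u = ((Ψ ζ₁ ^ i : K₂ˣ) : K₂) • u := by
    intro i u
    have h1 : ((a : G) ^ (j * i)) = ((a ^ (j * i) : A) : G) := (Subgroup.coe_zpow _ _ _).symm
    rw [h1, h₂.apply_eq, ← hjζ, ← zpow_natCast, ← zpow_mul, ← map_zpow]
    rfl
  have hθa : ∀ u, θ (ρ₁ a u) = ρ₂ ((a : G) ^ ((j : ℤ) * 1)) (θ u) := by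
    intro u
    rw [h₁.apply_eq, hθsmul, hρ₂a, zpow_one]
    rfl
  have hθx : ∀ u, ρ₂ x (θ u) = ρ₂ ((a : G) ^ (j * z)) (θ (ρ₁ x u)) := by
    intro u
    obtain ⟨l, rfl⟩ := hgenv u
    have hγψ : (γ' : K₂) = ψ ((γ * ζ₁ ^ z * t ^ (Q - 1) : K₁ˣ) : K₁) := by
      rw [← hzt]
      exact congrArg Units.val (Ψ.apply_symm_apply γ').symm
    have hψz : ((Ψ ζ₁ ^ z : K₂ˣ) : K₂) = ψ ((ζ₁ ^ z : K₁ˣ) : K₁) := by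
      rw [← map_zpow]; rfl
    rw [hx, hγ, hθ, hx₂, hγ', hρ₂a, smul_smul (l ^ Q), hθ, smul_smul, smul_smul, hγψ, hψz,
      ← map_pow, ← map_mul, ← map_mul]
    congr 2
    have ht : ((t⁻¹ : K₁ˣ) : K₁) ^ Q * ((t ^ (Q - 1) : K₁ˣ) : K₁) = ((t⁻¹ : K₁ˣ) : K₁) := by
      obtain ⟨q, rfl⟩ := Nat.exists_eq_add_of_le' hQ.le
      rw [← Units.val_pow_eq_pow_val, ← Units.val_mul]
      congr 1
      rw [Nat.add_sub_cancel, pow_succ, inv_pow]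
      simp [mul_comm]
    rw [mul_pow, Units.val_mul, Units.val_mul]
    linear_combination (l ^ Q * γ * (ζ₁ ^ z : K₁ˣ)) * ht
  refine ⟨θ, fun g => ?_⟩
  have hmul : ∀ g h, (∃ g', ∀ v, θ (ρ₁ g v) = ρ₂ g' (θ v)) →
      (∃ g', ∀ v, θ (ρ₁ h v) = ρ₂ g' (θ v)) → ∃ g', ∀ v, θ (ρ₁ (g * h) v) = ρ₂ g' (θ v) := by
    rintro g h ⟨g', hg⟩ ⟨h', hh⟩
    exact ⟨g' * h', fun v => by simp [hg, hh]⟩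
  have hpow : ∀ g, (∃ g', ∀ v, θ (ρ₁ g v) = ρ₂ g' (θ v)) →
      ∀ i : ℕ, ∃ g', ∀ v, θ (ρ₁ (g ^ i) v) = ρ₂ g' (θ v) := by
    intro g hg i
    induction i with
    | zero => exact ⟨1, by simp⟩
    | succ i ih => rw [pow_succ]; exact hmul _ _ ih hg
  obtain ⟨i, hi⟩ := hgen g
  obtain ⟨b, hb, rfl⟩ := h₁.exists_eq_pow_mul hinj₁ hcent hx hi
  obtain ⟨r, rfl⟩ := hgenA b hb
  -- `θ` carries the action of `x` to that of `a ^ (-(j * z)) * x`, and that of `a` to that of `a ^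
  -- j`.
  refine hmul _ _ (hpow x ⟨((a : G) ^ (j * z))⁻¹ * x, fun u => ?_⟩ i) (hpow a ⟨_, hθa⟩ r)
  rw [map_mul, Module.End.mul_apply, hθx, ρ₂.inv_self_apply]

end Representation.IsScalarOn

/-! ### Return to linear groups. -/

theorem Representation.IsIrreducible.comp_mulEquiv {F G H V : Type*} [Field F] [Group G] [Group H]
    [AddCommGroup V] [Module F V] {ρ : Representation F H V} (hρ : ρ.IsIrreducible) (φ : G ≃* H) :
    Representation.IsIrreducible (ρ.comp φ.toMonoidHom : Representation F G V) := by
  have := hρ.nontrivial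
  refine { exists_pair_ne := ⟨⊥, ⊤, fun h => ?_⟩, eq_bot_or_eq_top := fun W => ?_ }
  · exact bot_ne_top (congrArg Subrepresentation.toSubmodule h : (⊥ : Submodule F V) = ⊤)
  · by_cases hW : W.toSubmodule = ⊥
    · left
      cases W
      cases hW
      rfl
    · right
      have := hρ.eq_top_of_invariant W.toSubmodule (fun h v hv => by
        simpa using W.apply_mem_toSubmodule (φ.symm h) hv) hW
      cases W
      cases this
      rfl

namespace NilpotentPrimitive

variable {F : Type*} [Field F] {n : ℕ} {G H : Subgroup (Matrix.GeneralLinearGroup (Fin n) F)}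

theorem naturalRep_injective : Function.Injective (naturalRep G) := fun _ _ hgh =>
  Subtype.ext (Units.ext (Matrix.toLin'.injective hgh))

theorem IsPrimitive.hasNoImprimitivity (hG : IsPrimitive G) :
    (naturalRep G).HasNoImprimitivity :=
  fun k W hk hne hint hperm => hG.2 k W ⟨hk, hne, hint, hperm⟩

/-- The intertwiner only puts the conjugate of `G` inside `H`; the isomorphism supplies equal
orders, hence equality. -/
theorem exists_conj_eq_of_linearEquiv [Finite F] (φ : G ≃* H)
    (θ : (Fin n → F) ≃ₗ[F] (Fin n → F))
    (h : ∀ g, ∃ g', ∀ v, θ (naturalRep G g v) = naturalRep H g' (θ v)) :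
    ∃ x : Matrix.GeneralLinearGroup (Fin n) F, G.map (MulAut.conj x).toMonoidHom = H := by
  let x : Matrix.GeneralLinearGroup (Fin n) F :=
    Matrix.GeneralLinearGroup.toLin.symm (LinearMap.GeneralLinearGroup.ofLinearEquiv θ)
  have hx : ∀ v, Matrix.toLin' x.val v = θ v := fun v => by
    have h1 : Matrix.GeneralLinearGroup.toLin x = LinearMap.GeneralLinearGroup.ofLinearEquiv θ :=
      MulEquiv.apply_symm_apply _ _
    exact LinearMap.congr_fun (congrArg Units.val h1) v
  refine ⟨x, Subgroup.eq_of_le_of_card_ge ?_ ?_⟩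
  · rintro _ ⟨g, hg, rfl⟩
    obtain ⟨g', hg'⟩ := h ⟨g, hg⟩
    have hmul : x * g = (g' : Matrix.GeneralLinearGroup (Fin n) F) * x := by
      refine Units.ext (Matrix.toLin'.injective (LinearMap.ext fun v => ?_))
      rw [Units.val_mul, Units.val_mul, Matrix.toLin'_mul, Matrix.toLin'_mul,
        LinearMap.comp_apply, LinearMap.comp_apply, hx, hx]
      exact hg' v
    have : (MulAut.conj x).toMonoidHom g = g' := by
      simp [MulAut.conj_apply, hmul]
    rw [this]
    exact g'.2
  · rw [Subgroup.card_map_of_injective (MulAut.conj x).injective, Nat.card_congr φ.toEquiv]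

theorem exists_conj_eq_of_mulEquiv [Finite F] (hGnil : Group.IsNilpotent G)
    (hG : IsPrimitive G) (hH : IsPrimitive H) (φ : G ≃* H) :
    ∃ x : Matrix.GeneralLinearGroup (Fin n) F, G.map (MulAut.conj x).toMonoidHom = H := by
  obtain ⟨A, hA, hcomm, hcent⟩ :=
    Group.IsNilpotent.exists_normal_isMulCommutative_centralizer_le G
  let ρ₂ : Representation F G (Fin n → F) := (naturalRep H).comp φ.toMonoidHom
  have hirr₂ : ρ₂.IsIrreducible := hH.1.comp_mulEquiv φ
  have hprim₂ : ρ₂.HasNoImprimitivity := fun k W hk hne hint hperm =>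
    hH.hasNoImprimitivity k W hk hne hint fun h i => by
      simpa [ρ₂] using hperm (φ.symm h) i
  obtain ⟨K₁, _, _, _, _, _, χ₁, h₁, hadj₁⟩ :=
    Representation.exists_field_of_hasNoImprimitivity hG.1 hG.hasNoImprimitivity A hcomm
  obtain ⟨θ, hθ⟩ : ∃ θ : (Fin n → F) ≃ₗ[F] (Fin n → F),
      ∀ g, ∃ g', ∀ v, θ (naturalRep G g v) = ρ₂ g' (θ v) := by
    obtain ⟨K₂, _, _, _, _, _, χ₂, h₂, hadj₂⟩ :=
      Representation.exists_field_of_hasNoImprimitivity hirr₂ hprim₂ A hcomm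
    exact Representation.IsScalarOn.exists_intertwining_up_to_image (ρ₁ := naturalRep G)
      (ρ₂ := ρ₂) ⟨h₁, hadj₁⟩ ⟨h₂, hadj₂⟩ hG.1 hirr₂ naturalRep_injective
      (naturalRep_injective.comp φ.injective) hA hcent rfl
  exact exists_conj_eq_of_linearEquiv φ θ fun g => (hθ g).imp' φ fun _ h => h

end NilpotentPrimitive

theorem theorem5p8 {F : Type*} [Field F] [Finite F] {n : ℕ} (hn : 1 < n)
    (G H : Subgroup (Matrix.GeneralLinearGroup (Fin n) F))
    (hGnil : Group.IsNilpotent G) (hHnil : Group.IsNilpotent H)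
    (hGprim : NilpotentPrimitive.IsPrimitive G) (hHprim : NilpotentPrimitive.IsPrimitive H) :
    (∃ x : Matrix.GeneralLinearGroup (Fin n) F, G.map (MulAut.conj x).toMonoidHom = H) ↔
      Nonempty (G ≃* H) := by
  constructor
  · rintro ⟨x, rfl⟩
    exact ⟨G.equivMapOfInjective _ (MulAut.conj x).injective⟩
  · rintro ⟨φ⟩
    exact NilpotentPrimitive.exists_conj_eq_of_mulEquiv hGnil hGprim hHprim φ
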